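/- For $\alpha>0$ and $\beta\in\mathbb{R}$ let $$E_{\alpha,\beta}(z)=\sum_{k=0}^{\infty}\frac{z^k}{\Gamma(\alpha k+\beta)},\qquad z\in\mathbb{C},$$ be the two-parameter Mittag-Leffler function (with $1/\Gamma=0$ at the poles of $\Gamma$), which is real on the real axis. Suppose that $\alpha\in(1,2)$ and $\beta\in[0,\alpha-1)\cup(\alpha,\infty)$. Then the inequality $$|E_{\alpha,\beta}(z)|\ \ge\ E_{\alpha,\beta}(\operatorname{Re} z)$$ does not hold for all $z\in\mathbb{C}$. More precisely, there exist $R\in\mathbb{R}$ and $\delta>0$ (depending on $\alpha,\beta$) such that $$|E_{\alpha,\beta}(z)|\ <\ E_{\alpha,\beta}(\operatorname{Re} z)$$ for all $z\in\mathbb{C}$ with $\operatorname{Re} z<R$ and $0<|\operatorname{Im} z|<\delta$. -/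

import Mathlib

/-- The two-parameter Mittag-Leffler function
`E_{α,β}(z) = ∑_{k ≥ 0} z ^ k / Γ(α k + β)`, an entire function of `z` for `α > 0` and `β` real.
At the poles of `Γ` Mathlib sets `Γ = 0`, so the corresponding coefficient `1 / Γ` is `0`, which is
the usual convention for the reciprocal Gamma function (for instance for `β = 0`, `k = 0`). -/
noncomputable def mittagLeffler (α β : ℝ) (z : ℂ) : ℂ :=
  ∑' k : ℕ, z ^ k / (Real.Gamma (α * (k : ℝ) + β) : ℂ)

/-- The series defining the Mittag-Leffler function converges absolutely everywhere
(recorded here in the parameter range `α ≥ 1`, `β ≥ 0`). -/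
theorem summable_mittagLeffler {α β : ℝ} (hα : 1 ≤ α) (hβ : 0 ≤ β) (z : ℂ) :
    Summable (fun k : ℕ => z ^ k / (Real.Gamma (α * (k : ℝ) + β) : ℂ)) := by
  rw [← summable_nat_add_iff 2]
  refine Summable.of_norm_bounded (g := fun k : ℕ => ‖z‖ ^ 2 * (‖z‖ ^ k / (k.factorial : ℝ)))
    ((Real.summable_pow_div_factorial ‖z‖).mul_left _) ?_
  intro k
  have hk : (0 : ℝ) ≤ k := Nat.cast_nonneg k
  have h1 : ((k : ℝ) + 2) ≤ α * ((k : ℝ) + 2) + β := by nlinarith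
  have h2 : (k.factorial : ℝ) ≤ Real.Gamma (α * ((k + 2 : ℕ) : ℝ) + β) := by
    have h3 : Real.Gamma ((k : ℝ) + 2) ≤ Real.Gamma (α * ((k : ℝ) + 2) + β) :=
      Real.Gamma_strictMonoOn_Ici.monotoneOn (by simp only [Set.mem_Ici]; linarith)
        (by simp only [Set.mem_Ici]; linarith) h1
    have h4 : Real.Gamma ((k : ℝ) + 2) = ((k + 1).factorial : ℝ) := by
      rw [← Real.Gamma_nat_eq_factorial]; push_cast; ring_nf
    rw [h4] at h3
    have h5 : (k.factorial : ℝ) ≤ ((k + 1).factorial : ℝ) := by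
      exact_mod_cast Nat.factorial_le (Nat.le_succ k)
    push_cast
    linarith
  have h0 : (0 : ℝ) < k.factorial := by exact_mod_cast k.factorial_pos
  rw [norm_div, norm_pow, Complex.norm_real, Real.norm_of_nonneg (h0.le.trans h2), pow_add,
    mul_comm (‖z‖ ^ k), mul_div_assoc]
  gcongr

/-- The Mittag-Leffler function is real on the real axis, so that its value at a real point is
the real part of that value. -/
theorem mittagLeffler_ofReal (α β x : ℝ) :
    (((mittagLeffler α β (x : ℂ)).re : ℝ) : ℂ) = mittagLeffler α β (x : ℂ) := by
  have h : mittagLeffler α β (x : ℂ)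
      = ((∑' k : ℕ, x ^ k / Real.Gamma (α * (k : ℝ) + β) : ℝ) : ℂ) := by
    rw [mittagLeffler, Complex.ofReal_tsum]
    push_cast
    rfl
  rw [h, Complex.ofReal_re]

/-! Put `F = E_{α,β-α}` and `c = 1/Γ(β-α)`; the admissible `β` are such that `c > 0`. Splitting off
the first term of the series gives `z E_{α,β}(z) = -(c - F z)`, so if `F` is small then `E_{α,β}(z)`
is close to `-c/z`, whose modulus is strictly less than `c/|Re z|` off the axis. Quantitatively
(`exists_norm_sub_mul_lt`), with `X = -Re z` and `y = Im z`, the passage from `|Re z|²` to `|z|²`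
gains `y²`, while a decay `F = O(1/X)` in a sector costs only `O(y²/X)`, by Cauchy estimates and
because `F` is real on the axis.

The decay follows by the same splitting from boundedness of every `E_{α,γ}` on a sector around the
negative axis (`boundedNearNegAxis_mittagLeffler`). For `γ = 1` this is an energy estimate: `u(t) =
E_{α,1}(-λ t^α)` satisfies `Γ(α-1) u' = -λ (t^{α-2} * u)`, and the kernel `λ t^{-(2-α)}` is of
positive type for `|arg λ| < (2-α)π/2`, being a superposition of exponentials `exp(-σ r t)` with `Re
σ > 0`. Hence `|u(1)| ≤ |u(0)| = 1`. Fractional integration raises `γ` and differentiation lowers it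
by one, which reaches every real `γ`. -/

/-! ### Laplace transform of powers on the right half-plane. -/

open MeasureTheory Set in
/-- Convergence of the Laplace transform of `r ^ p` on the half-plane `0 < re w`. -/
theorem integrableOn_rpow_mul_cexp_neg_mul {p : ℝ} (hp : -1 < p) {w : ℂ} (hw : 0 < w.re) :
    IntegrableOn (fun r : ℝ => ((r ^ p : ℝ) : ℂ) * Complex.exp (-(w * r))) (Ioi 0) := by
  have h := integrableOn_rpow_mul_exp_neg_mul_rpow (p := 1) (s := p) (b := w.re) hp one_pos hw
  refine Integrable.mono' h ?_ ?_
  · refine AEStronglyMeasurable.mul ?_ ?_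
    · exact (Complex.measurable_ofReal.comp
        (measurable_id.pow_const p)).aestronglyMeasurable
    · exact (by fun_prop : Continuous fun r : ℝ => Complex.exp (-(w * r))).aestronglyMeasurable
  · refine (ae_restrict_iff' measurableSet_Ioi).2 (.of_forall fun r (hr : 0 < r) => ?_)
    rw [norm_mul, Complex.norm_exp, Complex.norm_real, Real.norm_of_nonneg (by positivity)]
    simp

open MeasureTheory Set in
/-- The norm of the integrand of the Laplace transform of `r ^ (a - 1)`. -/
theorem integral_norm_rpow_mul_cexp_neg_mul {a : ℝ} (ha : 0 < a) {w : ℂ} (hw : 0 < w.re) :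
    ∫ r in Ioi (0 : ℝ), ‖((r ^ (a - 1) : ℝ) : ℂ) * Complex.exp (-(w * r))‖
      = (1 / w.re) ^ a * Real.Gamma a := by
  rw [← Real.integral_rpow_mul_exp_neg_mul_Ioi ha hw]
  refine setIntegral_congr_fun measurableSet_Ioi fun r (hr : 0 < r) => ?_
  rw [norm_mul, Complex.norm_exp, Complex.norm_real, Real.norm_of_nonneg (by positivity)]
  simp

-- Differentiation under the integral sign: on the disc of radius `re w / 2` the differentiated
-- integrand is dominated by `r ^ a * exp (-(re w / 2) r)`.
open MeasureTheory Set in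
theorem differentiableAt_integral_rpow_mul_cexp_neg_mul {a : ℝ} (ha : 0 < a) {w : ℂ}
    (hw : 0 < w.re) :
    DifferentiableAt ℂ (fun w : ℂ => ∫ r in Ioi (0 : ℝ),
      ((r ^ (a - 1) : ℝ) : ℂ) * Complex.exp (-(w * r))) w := by
  have hmeas : ∀ v : ℂ, AEStronglyMeasurable
      (fun r : ℝ => ((r ^ (a - 1) : ℝ) : ℂ) * Complex.exp (-(v * r)))
      (volume.restrict (Ioi 0)) := fun v => by
    refine AEStronglyMeasurable.mul ?_ ?_
    · exact (Complex.measurable_ofReal.comp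
        (measurable_id.pow_const _)).aestronglyMeasurable
    · exact (by fun_prop : Continuous fun r : ℝ => Complex.exp (-(v * r))).aestronglyMeasurable
  have hint := integrableOn_rpow_mul_exp_neg_mul_rpow (p := 1) (s := a) (b := w.re / 2)
    (by linarith) one_pos (by linarith)
  refine (hasDerivAt_integral_of_dominated_loc_of_deriv_le
    (F' := fun (v : ℂ) (r : ℝ) => -(r : ℂ) *
      (((r ^ (a - 1) : ℝ) : ℂ) * Complex.exp (-(v * r))))
    (bound := fun r => r ^ a * Real.exp (-(w.re / 2) * r ^ (1 : ℝ)))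
    (Metric.ball_mem_nhds w (by linarith : 0 < w.re / 2))
    (.of_forall hmeas) (integrableOn_rpow_mul_cexp_neg_mul (by linarith) hw) ?_ ?_ hint
    ?_).2.differentiableAt
  · exact (by fun_prop : Continuous fun r : ℝ => -(r : ℂ)).aestronglyMeasurable.mul (hmeas w)
  · refine (ae_restrict_iff' measurableSet_Ioi).2 (.of_forall fun r (hr : 0 < r) v hv => ?_)
    have hv' : w.re / 2 < v.re := by
      have h1 := (Complex.abs_re_le_norm (v - w)).trans_lt (mem_ball_iff_norm.1 hv)
      rw [Complex.sub_re] at h1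
      linarith [(abs_lt.1 h1).1]
    rw [norm_mul, norm_mul, Complex.norm_exp, Complex.norm_real,
      Real.norm_of_nonneg (by positivity), norm_neg, Complex.norm_real,
      Real.norm_of_nonneg hr.le, ← mul_assoc]
    have : r * r ^ (a - 1) = r ^ a := by
      nth_rewrite 1 [← Real.rpow_one r]
      rw [← Real.rpow_add hr]; ring_nf
    rw [this]
    gcongr
    simp
    nlinarith
  · refine .of_forall fun r v _ => ?_
    have h1 : HasDerivAt (fun v : ℂ => -(v * (r : ℂ))) (-(r : ℂ)) v := by
      simpa using! ((hasDerivAt_id v).mul_const (r : ℂ)).neg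
    have := (h1.cexp).const_mul ((r ^ (a - 1) : ℝ) : ℂ)
    exact this.congr_deriv (by ring)

open MeasureTheory Set in
/-- The Laplace transform of `r ^ (a - 1)` on the half-plane `0 < re w`. -/
theorem integral_rpow_mul_cexp_neg_mul_Ioi {a : ℝ} (ha : 0 < a) {w : ℂ} (hw : 0 < w.re) :
    ∫ r in Ioi (0 : ℝ), ((r ^ (a - 1) : ℝ) : ℂ) * Complex.exp (-(w * r))
      = (1 / w) ^ (a : ℂ) * Real.Gamma a := by
  have hopen : IsOpen {w : ℂ | 0 < w.re} := isOpen_lt continuous_const Complex.continuous_re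
  have hconv : IsPreconnected {w : ℂ | 0 < w.re} :=
    (convex_halfSpace_re_gt 0).isPreconnected
  have hf : AnalyticOnNhd ℂ (fun w : ℂ => ∫ r in Ioi (0 : ℝ),
      ((r ^ (a - 1) : ℝ) : ℂ) * Complex.exp (-(w * r))) {w : ℂ | 0 < w.re} :=
    DifferentiableOn.analyticOnNhd (fun v hv =>
      (differentiableAt_integral_rpow_mul_cexp_neg_mul ha hv).differentiableWithinAt) hopen
  have hg : AnalyticOnNhd ℂ (fun w : ℂ => (1 / w) ^ (a : ℂ) * Real.Gamma a)
      {w : ℂ | 0 < w.re} := by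
    refine DifferentiableOn.analyticOnNhd (fun v hv => ?_) hopen
    have hv0 : v ≠ 0 := by rintro rfl; simp at hv
    refine DifferentiableAt.differentiableWithinAt ?_
    refine (DifferentiableAt.cpow ?_ (differentiableAt_const _) ?_).mul_const _
    · exact (differentiableAt_const _).div differentiableAt_id hv0
    · left
      rw [one_div, Complex.inv_re]
      exact div_pos hv (Complex.normSq_pos.2 hv0)
  have hreal : ∀ x : ℝ, 0 < x → ∫ r in Ioi (0 : ℝ),
      ((r ^ (a - 1) : ℝ) : ℂ) * Complex.exp (-((x : ℂ) * r))
      = (1 / (x : ℂ)) ^ (a : ℂ) * Real.Gamma a := by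
    intro x hx
    have h := Real.integral_rpow_mul_exp_neg_mul_Ioi ha hx
    have h2 : (1 / (x : ℂ)) ^ (a : ℂ) * Real.Gamma a
        = (((1 / x) ^ a * Real.Gamma a : ℝ) : ℂ) := by
      rw [Complex.ofReal_mul, Complex.ofReal_cpow (by positivity)]
      push_cast; rfl
    rw [h2, ← h, ← integral_complex_ofReal]
    push_cast
    rfl
  -- Identity theorem: the two analytic functions agree at the real points `1 + 1/(n+1)`, which
  -- accumulate at `1`.
  refine hf.eqOn_of_preconnected_of_frequently_eq hg hconv (z₀ := 1) (by simp) ?_ hw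
  have ht : Filter.Tendsto (fun n : ℕ => (((1 + 1 / ((n : ℝ) + 1) : ℝ)) : ℂ)) Filter.atTop
      (nhdsWithin 1 {1}ᶜ) := by
    refine tendsto_nhdsWithin_iff.2 ⟨?_, .of_forall fun n => ?_⟩
    · have := (tendsto_one_div_add_atTop_nhds_zero_nat (𝕜 := ℝ)).const_add 1
      have h2 := (Complex.continuous_ofReal.tendsto _).comp this
      simpa [Function.comp_def] using h2
    · have : (0 : ℝ) < 1 / ((n : ℝ) + 1) := by positivity
      simp only [mem_compl_iff, mem_singleton_iff, Complex.ofReal_eq_one]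
      linarith
  exact ht.frequently (.of_forall fun n => hreal _ (by positivity))

/-! ### Recursion and derivative for an arbitrary real second parameter. -/

/-- The series defining the Mittag-Leffler function converges for every real second parameter. -/
theorem summable_mittagLeffler_of_one_le {α : ℝ} (hα : 1 ≤ α) (γ : ℝ) (z : ℂ) :
    Summable (fun k : ℕ => z ^ k / (Real.Gamma (α * (k : ℝ) + γ) : ℂ)) := by
  obtain ⟨n, hn⟩ := exists_nat_ge (-γ)
  rw [← summable_nat_add_iff n]
  have hn0 : (0 : ℝ) ≤ n := n.cast_nonneg
  refine ((summable_mittagLeffler hα (β := α * n + γ) (by nlinarith) z).mul_left (z ^ n)).congr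
    fun k => ?_
  have : α * (k : ℝ) + (α * n + γ) = α * ((k + n : ℕ) : ℝ) + γ := by push_cast; ring
  rw [this, pow_add]
  ring

/-- The `k = 0` term is split off. Solved for the last factor, this gains a power `1/z` at the price
of lowering the second parameter by `α`. -/
theorem mittagLeffler_eq_add_mul {α : ℝ} (hα : 1 ≤ α) (γ : ℝ) (z : ℂ) :
    mittagLeffler α γ z = 1 / (Real.Gamma γ : ℂ) + z * mittagLeffler α (γ + α) z := by
  rw [mittagLeffler, (summable_mittagLeffler_of_one_le hα γ z).tsum_eq_zero_add, mittagLeffler,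
    ← tsum_mul_left]
  congr 1
  · simp
  · refine tsum_congr fun k => ?_
    have : α * ((k + 1 : ℕ) : ℝ) + γ = α * k + (γ + α) := by push_cast; ring
    rw [this]
    ring

theorem norm_mittagLeffler_term_le (α γ : ℝ) (k : ℕ) {R : ℝ} {w : ℂ}
    (hw : w ∈ Metric.ball (0 : ℂ) R) :
    ‖w ^ k / (Real.Gamma (α * (k : ℝ) + γ) : ℂ)‖
      ≤ ‖(R : ℂ) ^ k / (Real.Gamma (α * (k : ℝ) + γ) : ℂ)‖ := by
  rw [norm_div, norm_div, norm_pow, norm_pow]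
  have : ‖w‖ ≤ ‖(R : ℂ)‖ := by
    rw [Complex.norm_real]
    exact (mem_ball_zero_iff.1 hw).le.trans (le_abs_self R)
  gcongr

theorem differentiable_mittagLeffler {α : ℝ} (hα : 1 ≤ α) (γ : ℝ) :
    Differentiable ℂ (mittagLeffler α γ) := by
  intro z
  have h := Complex.differentiableOn_tsum_of_summable_norm
    (summable_mittagLeffler_of_one_le hα γ ((‖z‖ + 1 : ℝ) : ℂ)).norm
    (U := Metric.ball 0 (‖z‖ + 1))
    (fun k => (by fun_prop : Differentiable ℂ
      fun w : ℂ => w ^ k / (Real.Gamma (α * (k : ℝ) + γ) : ℂ)).differentiableOn)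
    Metric.isOpen_ball (fun k w hw => norm_mittagLeffler_term_le α γ k hw)
  exact h.differentiableAt (Metric.isOpen_ball.mem_nhds (by simp))

/-- The reciprocal Gamma function satisfies its functional equation at every real point. -/
theorem Real.self_div_Gamma_add_one (s : ℝ) : s / Real.Gamma (s + 1) = 1 / Real.Gamma s := by
  rcases eq_or_ne s 0 with rfl | hs
  -- Both sides vanish at `0`, since `Γ 0 = 0` by convention.
  · simp
  · rw [Real.Gamma_add_one hs, ← div_div, div_self hs]

/-- Termwise, `α k = (α k + γ - 1) - (γ - 1)`, and the first summand shifts the argument of the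
reciprocal Gamma function by one. -/
theorem mul_deriv_mittagLeffler {α : ℝ} (hα : 1 ≤ α) (γ : ℝ) (z : ℂ) :
    α * (z * deriv (mittagLeffler α γ) z)
      = mittagLeffler α (γ - 1) z - (γ - 1) * mittagLeffler α γ z := by
  have h := Complex.hasSum_deriv_of_summable_norm
    (summable_mittagLeffler_of_one_le hα γ ((‖z‖ + 1 : ℝ) : ℂ)).norm
    (U := Metric.ball 0 (‖z‖ + 1))
    (fun k => (by fun_prop : Differentiable ℂ
      fun w : ℂ => w ^ k / (Real.Gamma (α * (k : ℝ) + γ) : ℂ)).differentiableOn)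
    Metric.isOpen_ball (fun k w hw => norm_mittagLeffler_term_le α γ k hw)
    (z := z) (by simp)
  change HasSum _ (deriv (mittagLeffler α γ) z) at h
  have h1 := (h.mul_left z).mul_left (α : ℂ)
  have h2 := (summable_mittagLeffler_of_one_le hα γ z).hasSum.mul_left ((γ : ℂ) - 1)
  have h3 := (summable_mittagLeffler_of_one_le hα (γ - 1) z).hasSum
  rw [eq_sub_iff_add_eq]
  refine (h1.add h2).unique ?_
  refine h3.congr_fun fun k => ?_
  have hd : deriv (fun w : ℂ => w ^ k / (Real.Gamma (α * (k : ℝ) + γ) : ℂ)) z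
      = k * z ^ (k - 1) / (Real.Gamma (α * (k : ℝ) + γ) : ℂ) := by
    simp
  have hz : z * (k * z ^ (k - 1)) = k * z ^ k := by
    rcases k with _ | k
    · simp
    · simp only [Nat.add_sub_cancel]; ring
  have hG : 1 / (Real.Gamma (α * k + (γ - 1)) : ℂ)
      = (α * k + (γ - 1)) / (Real.Gamma (α * (k : ℝ) + γ) : ℂ) := by
    have := Real.self_div_Gamma_add_one (α * k + (γ - 1))
    rw [show α * k + (γ - 1) + 1 = α * (k : ℝ) + γ by ring] at this
    exact_mod_cast this.symm
  rw [hd, ← mul_div_assoc z, hz, div_eq_mul_one_div (z ^ k) (Real.Gamma (α * k + (γ - 1)) : ℂ), hG]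
  ring

/-! ### Beta integrals and fractional integration. -/

open MeasureTheory Set in
theorem integrableOn_rpow_mul_one_sub_rpow {u v : ℝ} (hu : 0 < u) (hv : 0 < v) :
    IntegrableOn (fun q : ℝ => q ^ (u - 1) * (1 - q) ^ (v - 1)) (Ioo 0 1) := by
  have h := Complex.betaIntegral_convergent (u := (u : ℂ)) (v := (v : ℂ)) (by simpa) (by simpa)
  rw [intervalIntegrable_iff_integrableOn_Ioo_of_le zero_le_one] at h
  refine (Integrable.re h).congr ((ae_restrict_iff' measurableSet_Ioo).2 (.of_forall ?_))
  rintro q ⟨h0, h1⟩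
  have : ((q : ℂ) ^ ((u : ℂ) - 1) * (1 - (q : ℂ)) ^ ((v : ℂ) - 1))
      = ((q ^ (u - 1) * (1 - q) ^ (v - 1) : ℝ) : ℂ) := by
    rw [Complex.ofReal_mul, Complex.ofReal_cpow h0.le, Complex.ofReal_cpow (by linarith)]
    push_cast; rfl
  simp only [this]
  exact Complex.ofReal_re _

open MeasureTheory Set in
theorem integral_rpow_mul_one_sub_rpow {u v : ℝ} (hu : 0 < u) (hv : 0 < v) :
    ∫ q in Ioo (0 : ℝ) 1, q ^ (u - 1) * (1 - q) ^ (v - 1)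
      = Real.Gamma u * Real.Gamma v / Real.Gamma (u + v) := by
  have h := Complex.betaIntegral_eq_Gamma_mul_div (u : ℂ) (v : ℂ) (by simpa) (by simpa)
  rw [Complex.betaIntegral, intervalIntegral.integral_of_le zero_le_one,
    integral_Ioc_eq_integral_Ioo] at h
  have h2 : ∫ q in Ioo (0 : ℝ) 1, (q : ℂ) ^ ((u : ℂ) - 1) * (1 - (q : ℂ)) ^ ((v : ℂ) - 1)
      = ∫ q in Ioo (0 : ℝ) 1, ((q ^ (u - 1) * (1 - q) ^ (v - 1) : ℝ) : ℂ) := by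
    refine setIntegral_congr_fun measurableSet_Ioo fun q hq => ?_
    obtain ⟨h0, h1⟩ := hq
    rw [Complex.ofReal_mul, Complex.ofReal_cpow h0.le, Complex.ofReal_cpow (by linarith)]
    push_cast; rfl
  rw [h2, integral_complex_ofReal, ← Complex.ofReal_add, Complex.Gamma_ofReal,
    Complex.Gamma_ofReal, Complex.Gamma_ofReal] at h
  exact_mod_cast h

open MeasureTheory Set in
/-- Fractional integration raises the second parameter of the Mittag-Leffler function. -/
theorem integral_rpow_mul_mittagLeffler {α β μ : ℝ} (hα : 1 ≤ α) (hβ : 0 < β) (hμ : 0 < μ)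
    (z : ℂ) :
    ∫ q in Ioo (0 : ℝ) 1, ((q ^ (β - 1) * (1 - q) ^ (μ - 1) : ℝ) : ℂ)
        * mittagLeffler α β (z * (q ^ α : ℝ))
      = Real.Gamma μ * mittagLeffler α (β + μ) z := by
  have hpos : ∀ k : ℕ, 0 < α * k + β := fun k => by positivity
  set F : ℕ → ℝ → ℂ := fun k q => (z ^ k / (Real.Gamma (α * (k : ℝ) + β) : ℂ)) *
    ((q ^ (α * k + β - 1) * (1 - q) ^ (μ - 1) : ℝ) : ℂ) with hF
  have hint : ∀ k, Integrable (F k) (volume.restrict (Ioo 0 1)) := fun k =>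
    (integrableOn_rpow_mul_one_sub_rpow (hpos k) hμ).ofReal.const_mul _
  have hGne : ∀ k : ℕ, (Real.Gamma (α * (k : ℝ) + β) : ℂ) ≠ 0 := fun k => by
    exact_mod_cast (Real.Gamma_pos_of_pos (hpos k)).ne'
  have hval : ∀ k, ∫ q in Ioo (0 : ℝ) 1, F k q
      = Real.Gamma μ * (z ^ k / (Real.Gamma (α * (k : ℝ) + (β + μ)) : ℂ)) := fun k => by
    rw [hF, integral_const_mul, integral_complex_ofReal,
      integral_rpow_mul_one_sub_rpow (hpos k) hμ]
    push_cast
    rw [add_assoc]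
    have := hGne k
    field_simp
  have hnorm : ∀ k, ∫ q in Ioo (0 : ℝ) 1, ‖F k q‖
      = Real.Gamma μ * ‖z ^ k / (Real.Gamma (α * (k : ℝ) + (β + μ)) : ℂ)‖ := fun k => by
    have : ∫ q in Ioo (0 : ℝ) 1, ‖F k q‖ = ∫ q in Ioo (0 : ℝ) 1,
        ‖(z ^ k / (Real.Gamma (α * (k : ℝ) + β) : ℂ))‖ *
          (q ^ (α * k + β - 1) * (1 - q) ^ (μ - 1)) := by
      refine setIntegral_congr_fun measurableSet_Ioo fun q hq => ?_
      obtain ⟨h0, h1⟩ := hq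
      have h1' : 0 < 1 - q := by linarith
      rw [hF, norm_mul, Complex.norm_real, Real.norm_of_nonneg (by positivity)]
    rw [this, integral_const_mul, integral_rpow_mul_one_sub_rpow (hpos k) hμ, norm_div, norm_div,
      Complex.norm_real, Complex.norm_real, Real.norm_of_nonneg (Real.Gamma_pos_of_pos (hpos k)).le,
      Real.norm_of_nonneg (Real.Gamma_pos_of_pos (by positivity : 0 < α * k + (β + μ))).le,
      add_assoc]
    have := (Real.Gamma_pos_of_pos (hpos k)).ne'
    field_simp
  -- Each term is a Beta integral; the integrals of the norms form a convergent Mittag-Leffler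
  -- series, which permits exchanging sum and integral.
  have hsum : Summable fun k => ∫ q in Ioo (0 : ℝ) 1, ‖F k q‖ := by
    simp_rw [hnorm]
    exact (summable_mittagLeffler_of_one_le hα (β + μ) z).norm.mul_left _
  have h := integral_tsum_of_summable_integral_norm hint hsum
  simp_rw [hval, tsum_mul_left] at h
  rw [mittagLeffler, h]
  refine setIntegral_congr_fun measurableSet_Ioo fun q hq => ?_
  obtain ⟨h0, h1⟩ := hq
  rw [mittagLeffler, ← tsum_mul_left]
  refine tsum_congr fun k => ?_
  have : q ^ (α * k + β - 1) = q ^ (β - 1) * (q ^ α) ^ k := by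
    rw [← Real.rpow_mul_natCast h0.le, ← Real.rpow_add h0]; ring_nf
  rw [hF]
  simp only [this]
  push_cast
  ring

/-! ### Convolution kernels of positive type. -/

theorem Complex.ofReal_mul_cpow {x : ℝ} (hx : 0 < x) {z : ℂ} (hz : z ≠ 0) (c : ℂ) :
    ((x : ℂ) * z) ^ c = (x : ℂ) ^ c * z ^ c := by
  have hx0 : (x : ℂ) ≠ 0 := Complex.ofReal_ne_zero.2 hx.ne'
  rw [Complex.cpow_def_of_ne_zero (mul_ne_zero hx0 hz), Complex.cpow_def_of_ne_zero hx0,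
    Complex.cpow_def_of_ne_zero hz, Complex.log_ofReal_mul hx hz, Complex.ofReal_log hx.le,
    add_mul, Complex.exp_add]

open MeasureTheory Set ComplexConjugate in
/-- The convolution kernel `t ↦ exp (-s t)` is of positive type when `0 ≤ re s`. -/
theorem re_integral_conj_mul_exp_convolution_nonneg {u : ℝ → ℂ} (hu : Continuous u) {s : ℂ}
    (hs : 0 ≤ s.re) :
    0 ≤ (∫ t in (0 : ℝ)..1, conj (u t) *
      ∫ τ in (0 : ℝ)..t, Complex.exp (-(s * (t - τ))) * u τ).re := by
  -- The convolution `v` solves `v' = u - s v`, `v 0 = 0`. Integrating the derivative of `‖v‖²`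
  -- gives `Re ∫ conj u · v = ‖v 1‖²/2 + Re s ∫ ‖v‖² ≥ 0`.
  set v : ℝ → ℂ := fun t => Complex.exp (-(s * t)) * ∫ τ in (0 : ℝ)..t, Complex.exp (s * τ) * u τ
    with hv
  have hconv : ∀ t : ℝ, ∫ τ in (0 : ℝ)..t, Complex.exp (-(s * (t - τ))) * u τ = v t := fun t => by
    rw [hv]
    simp only
    rw [← intervalIntegral.integral_const_mul]
    congr 1 with τ
    rw [← mul_assoc, ← Complex.exp_add]
    ring_nf
  have hexp : ∀ c : ℂ, Continuous fun t : ℝ => Complex.exp (c * t) := fun c => by fun_prop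
  have hdv : ∀ t, HasDerivAt v (u t - s * v t) t := fun t => by
    have h1 : HasDerivAt (fun t : ℝ => Complex.exp (-(s * t)))
        (Complex.exp (-(s * t)) * -(s * 1)) t := by
      have : HasDerivAt (fun t : ℝ => -(s * (t : ℂ))) (-(s * 1)) t :=
        (((hasDerivAt_id t).ofReal_comp).const_mul s).neg
      exact this.cexp
    have h2 : HasDerivAt (fun t : ℝ => ∫ τ in (0 : ℝ)..t, Complex.exp (s * τ) * u τ)
        (Complex.exp (s * t) * u t) t :=
      (((hexp s).mul hu).integral_hasStrictDerivAt 0 t).hasDerivAt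
    refine (h1.mul h2).congr_deriv ?_
    rw [hv, ← mul_assoc, ← Complex.exp_add]
    simp only [neg_add_cancel, Complex.exp_zero, one_mul]
    ring
  have hvc : Continuous v := continuous_iff_continuousAt.2 fun t => (hdv t).continuousAt
  have hN : ∀ t ∈ uIcc (0 : ℝ) 1, HasDerivAt (fun t => ‖v t‖ ^ 2)
      (2 * (conj (u t) * v t).re - 2 * (s.re * ‖v t‖ ^ 2)) t := fun t _ => by
    refine (hdv t).norm_sq.congr_deriv ?_
    rw [Complex.inner, ← Complex.normSq_eq_norm_sq, Complex.normSq_apply]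
    simp
    ring
  have hc1 : Continuous fun t => conj (u t) * v t := (Complex.continuous_conj.comp hu).mul hvc
  have hc2 : Continuous fun t => (conj (u t) * v t).re := Complex.continuous_re.comp hc1
  have hc3 : Continuous fun t => s.re * ‖v t‖ ^ 2 := by fun_prop
  have hftc := intervalIntegral.integral_eq_sub_of_hasDerivAt hN
    ((by fun_prop : Continuous fun t => 2 * (conj (u t) * v t).re - 2 * (s.re * ‖v t‖ ^ 2)
      ).intervalIntegrable 0 1)
  rw [intervalIntegral.integral_sub ((hc2.const_mul 2).intervalIntegrable _ _)
    ((hc3.const_mul 2).intervalIntegrable _ _), intervalIntegral.integral_const_mul,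
    intervalIntegral.integral_const_mul] at hftc
  have hv0 : v 0 = 0 := by simp [hv]
  have hnn : 0 ≤ ∫ t in (0 : ℝ)..1, s.re * ‖v t‖ ^ 2 :=
    intervalIntegral.integral_nonneg zero_le_one fun t _ => by positivity
  simp_rw [hconv]
  have hre : (∫ t in (0 : ℝ)..1, conj (u t) * v t).re = ∫ t in (0 : ℝ)..1, (conj (u t) * v t).re :=
    (Complex.reCLM.intervalIntegral_comp_comm (hc1.intervalIntegrable 0 1)).symm
  rw [hre]
  rw [hv0] at hftc
  have := sq_nonneg ‖v 1‖
  rw [norm_zero, zero_pow two_ne_zero, sub_zero] at hftc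
  linarith

-- Justifies Fubini for the superposition of exponentials, with `τ = t q` so that the domain is a
-- square. Integrating the norm over `r` leaves a multiple of `t (t (1-q))^{-a}`, integrable because
-- `a < 1`.
open MeasureTheory Set ComplexConjugate in
theorem integrable_fractional_kernel {a : ℝ} (ha : 0 < a) (ha1 : a < 1) {σ : ℂ} (hσ : 0 < σ.re)
    {u : ℝ → ℂ} (hu : Continuous u) :
    Integrable (fun x : (ℝ × ℝ) × ℝ => conj (u x.1.1) * x.1.1 * u (x.1.1 * x.1.2) *
        (((x.2 ^ (a - 1) : ℝ) : ℂ) * Complex.exp (-((σ * (x.1.1 * (1 - x.1.2)) : ℂ) * x.2))))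
      (((volume.restrict (Ioo (0 : ℝ) 1)).prod (volume.restrict (Ioo (0 : ℝ) 1))).prod
        (volume.restrict (Ioi (0 : ℝ)))) := by
  have hcc : Continuous fun t => conj (u t) := Complex.continuous_conj.comp hu
  have hm1 : Measurable fun x : (ℝ × ℝ) × ℝ => conj (u x.1.1) * x.1.1 * u (x.1.1 * x.1.2) :=
    (by fun_prop : Continuous _).measurable
  have hm2 : Measurable fun x : (ℝ × ℝ) × ℝ => ((x.2 ^ (a - 1) : ℝ) : ℂ) :=
    Complex.measurable_ofReal.comp (measurable_snd.pow_const _)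
  have hm3 : Measurable fun x : (ℝ × ℝ) × ℝ =>
      Complex.exp (-((σ * (x.1.1 * (1 - x.1.2)) : ℂ) * x.2)) :=
    (by fun_prop : Continuous _).measurable
  have hmeas : AEStronglyMeasurable (fun x : (ℝ × ℝ) × ℝ =>
      conj (u x.1.1) * x.1.1 * u (x.1.1 * x.1.2) *
        (((x.2 ^ (a - 1) : ℝ) : ℂ) * Complex.exp (-((σ * (x.1.1 * (1 - x.1.2)) : ℂ) * x.2))))
      (((volume.restrict (Ioo (0 : ℝ) 1)).prod (volume.restrict (Ioo (0 : ℝ) 1))).prod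
        (volume.restrict (Ioi (0 : ℝ)))) := (hm1.mul (hm2.mul hm3)).aestronglyMeasurable
  have hw : ∀ t q : ℝ, t ∈ Ioo (0 : ℝ) 1 → q ∈ Ioo (0 : ℝ) 1 →
      (σ * (t * (1 - q)) : ℂ).re = σ.re * (t * (1 - q)) := fun t q _ _ => by
    have : (σ * (t * (1 - q)) : ℂ) = σ * ((t * (1 - q) : ℝ) : ℂ) := by push_cast; rfl
    rw [this, Complex.re_mul_ofReal]
  have hwpos : ∀ t q : ℝ, t ∈ Ioo (0 : ℝ) 1 → q ∈ Ioo (0 : ℝ) 1 →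
      0 < σ.re * (t * (1 - q)) := fun t q ht hq =>
    mul_pos hσ (mul_pos ht.1 (by linarith [hq.2]))
  obtain ⟨M, hM⟩ := (isCompact_Icc (a := (0 : ℝ)) (b := 1)).exists_bound_of_continuousOn
    hu.continuousOn
  have hM0 : 0 ≤ M := (norm_nonneg _).trans (hM 0 (by simp))
  have hdom : Integrable (fun p : ℝ × ℝ => p.1 ^ (1 - a) * (1 - p.2) ^ (-a))
      ((volume.restrict (Ioo (0 : ℝ) 1)).prod (volume.restrict (Ioo (0 : ℝ) 1))) := by
    have h1 : IntegrableOn (fun t : ℝ => t ^ (1 - a)) (Ioo 0 1) := by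
      simpa [show 2 - a - 1 = 1 - a by ring] using
        integrableOn_rpow_mul_one_sub_rpow (u := 2 - a) (v := 1) (by linarith) one_pos
    have h2 : IntegrableOn (fun q : ℝ => (1 - q) ^ (-a)) (Ioo 0 1) := by
      simpa using integrableOn_rpow_mul_one_sub_rpow (u := 1) (v := 1 - a) one_pos (by linarith)
    exact Integrable.mul_prod (L := ℝ) h1 h2
  rw [integrable_prod_iff hmeas, Measure.prod_restrict]
  rw [Measure.prod_restrict] at hdom
  constructor
  · refine (ae_restrict_iff' (measurableSet_Ioo.prod measurableSet_Ioo)).2 (.of_forall ?_)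
    rintro ⟨t, q⟩ ⟨ht, hq⟩
    have := integrableOn_rpow_mul_cexp_neg_mul (p := a - 1) (by linarith)
      (by rw [hw t q ht hq]; exact hwpos t q ht hq : 0 < (σ * (t * (1 - q)) : ℂ).re)
    exact this.const_mul (conj (u t) * t * u (t * q))
  · refine Integrable.mono' (hdom.const_mul (M * M * ((1 / σ.re) ^ a * Real.Gamma a))) ?_ ?_
    · rw [← Measure.prod_restrict]
      exact hmeas.norm.integral_prod_right'
    · refine (ae_restrict_iff' (measurableSet_Ioo.prod measurableSet_Ioo)).2 (.of_forall ?_)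
      rintro ⟨t, q⟩ ⟨ht, hq⟩
      have hq' : 0 < 1 - q := by linarith [hq.2]
      have ht' := ht.1
      simp only [norm_mul (conj (u t) * (t : ℂ) * u (t * q))]
      rw [integral_const_mul, integral_norm_rpow_mul_cexp_neg_mul ha
        (by rw [hw t q ht hq]; exact hwpos t q ht hq), hw t q ht hq]
      have hG := Real.Gamma_pos_of_pos ha
      have hpw : (1 / (σ.re * (t * (1 - q)))) ^ a
          = (1 / σ.re) ^ a * (t ^ (-a) * (1 - q) ^ (-a)) := by
        rw [one_div, mul_inv, mul_inv, Real.mul_rpow (by positivity) (by positivity),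
          Real.mul_rpow (by positivity) (by positivity), Real.inv_rpow ht'.le, Real.inv_rpow hq'.le,
          Real.rpow_neg ht'.le, Real.rpow_neg hq'.le, one_div]
      have htp : t * t ^ (-a) = t ^ (1 - a) := by
        rw [sub_eq_add_neg, Real.rpow_add ht', Real.rpow_one]
      rw [hpw, ← htp, Real.norm_of_nonneg (by positivity), norm_mul, norm_mul, RCLike.norm_conj,
        Complex.norm_real, Real.norm_of_nonneg ht'.le]
      have hut := hM t ⟨ht.1.le, ht.2.le⟩
      have hutq := hM (t * q) ⟨by nlinarith [hq.1], by nlinarith [hq.1, hq.2, ht.2]⟩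
      calc ‖u t‖ * t * ‖u (t * q)‖ *
            ((1 / σ.re) ^ a * (t ^ (-a) * (1 - q) ^ (-a)) * Real.Gamma a)
          ≤ M * t * M * ((1 / σ.re) ^ a * (t ^ (-a) * (1 - q) ^ (-a)) * Real.Gamma a) := by
            gcongr
        _ = _ := by ring

open MeasureTheory Set ComplexConjugate in
/-- The convolution kernel `t ↦ t ^ (-a)`, `0 < a < 1`, multiplied by a complex number of
argument less than `a π / 2` in absolute value, is of positive type. -/
theorem re_integral_fractional_kernel_nonneg {a : ℝ} (ha : 0 < a) (ha1 : a < 1) {σ : ℂ}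
    (hσ : 0 < σ.re) {u : ℝ → ℂ} (hu : Continuous u) :
    0 ≤ (∫ t in Ioo (0 : ℝ) 1, conj (u t) * ((1 / σ) ^ (a : ℂ) * ((t ^ (1 - a) : ℝ) : ℂ) *
      ∫ q in Ioo (0 : ℝ) 1, (((1 - q) ^ (-a) : ℝ) : ℂ) * u (t * q))).re := by
  have hG := Real.Gamma_pos_of_pos ha
  have hint := integrable_fractional_kernel ha ha1 hσ hu
  have hσ0 : 1 / σ ≠ 0 := by
    refine one_div_ne_zero ?_
    rintro rfl
    simp at hσ
  -- Integrating over `r` first reproduces the fractional kernel at `t (1-q) = t - τ`.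
  have hinner : ∀ t ∈ Ioo (0 : ℝ) 1, ∀ q ∈ Ioo (0 : ℝ) 1,
      ∫ r in Ioi (0 : ℝ), conj (u t) * t * u (t * q) *
        (((r ^ (a - 1) : ℝ) : ℂ) * Complex.exp (-((σ * (t * (1 - q)) : ℂ) * r)))
      = Real.Gamma a * (conj (u t) * ((1 / σ) ^ (a : ℂ) * ((t ^ (1 - a) : ℝ) : ℂ) *
          ((((1 - q) ^ (-a) : ℝ) : ℂ) * u (t * q)))) := by
    intro t ht q hq
    have hq' : 0 < 1 - q := by linarith [hq.2]
    have ht' := ht.1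
    have hcast : (σ * (t * (1 - q)) : ℂ) = σ * ((t * (1 - q) : ℝ) : ℂ) := by push_cast; rfl
    rw [integral_const_mul, integral_rpow_mul_cexp_neg_mul_Ioi ha (by
      rw [hcast, Complex.re_mul_ofReal]; positivity), hcast]
    have hpw : (1 / (σ * ((t * (1 - q) : ℝ) : ℂ))) ^ (a : ℂ)
        = (1 / σ) ^ (a : ℂ) * ((t ^ (-a) * (1 - q) ^ (-a) : ℝ) : ℂ) := by
      rw [show 1 / (σ * ((t * (1 - q) : ℝ) : ℂ)) = ((((t * (1 - q))⁻¹ : ℝ)) : ℂ) * (1 / σ) by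
        push_cast; field_simp, Complex.ofReal_mul_cpow (by positivity) hσ0,
        ← Complex.ofReal_cpow (by positivity), mul_comm,
        Real.inv_rpow (by positivity), Real.mul_rpow ht'.le hq'.le, mul_inv,
        Real.rpow_neg ht'.le, Real.rpow_neg hq'.le]
    have htp : t ^ (1 - a) = t * t ^ (-a) := by
      rw [sub_eq_add_neg, Real.rpow_add ht', Real.rpow_one]
    rw [hpw, htp]
    push_cast
    ring
  have hswap := integral_integral_swap (f := fun p : ℝ × ℝ => fun r : ℝ =>
    conj (u p.1) * p.1 * u (p.1 * p.2) *
      (((r ^ (a - 1) : ℝ) : ℂ) * Complex.exp (-((σ * (p.1 * (1 - p.2)) : ℂ) * r)))) hint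
  rw [integral_prod _ hint.integral_prod_left] at hswap
  have hlhs : ∫ t in Ioo (0 : ℝ) 1, ∫ q in Ioo (0 : ℝ) 1, ∫ r in Ioi (0 : ℝ),
      conj (u t) * t * u (t * q) *
        (((r ^ (a - 1) : ℝ) : ℂ) * Complex.exp (-((σ * (t * (1 - q)) : ℂ) * r)))
      = Real.Gamma a * ∫ t in Ioo (0 : ℝ) 1, conj (u t) *
        ((1 / σ) ^ (a : ℂ) * ((t ^ (1 - a) : ℝ) : ℂ) *
          ∫ q in Ioo (0 : ℝ) 1, (((1 - q) ^ (-a) : ℝ) : ℂ) * u (t * q)) := by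
    rw [← integral_const_mul]
    refine setIntegral_congr_fun measurableSet_Ioo fun t ht => ?_
    rw [setIntegral_congr_fun measurableSet_Ioo (hinner t ht), integral_const_mul,
      integral_const_mul, integral_const_mul]
  -- Integrating over `r` last, each fixed `r` gives the exponential kernel with `s = σ r`, weighted
  -- by `r ^ (a - 1) ≥ 0`.
  have hrhs : ∀ᵐ r ∂(volume.restrict (Ioi (0 : ℝ))), 0 ≤ (∫ p : ℝ × ℝ,
      conj (u p.1) * p.1 * u (p.1 * p.2) *
        (((r ^ (a - 1) : ℝ) : ℂ) * Complex.exp (-((σ * (p.1 * (1 - p.2)) : ℂ) * r)))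
      ∂((volume.restrict (Ioo (0 : ℝ) 1)).prod (volume.restrict (Ioo (0 : ℝ) 1)))).re := by
    filter_upwards [hint.prod_left_ae, ae_restrict_mem measurableSet_Ioi] with r hr hr0
    have hr0' : (0 : ℝ) < r := hr0
    rw [integral_prod _ hr]
    have hpos := re_integral_conj_mul_exp_convolution_nonneg hu (s := σ * r)
      (by rw [Complex.re_mul_ofReal]; positivity)
    have heq : ∫ t in Ioo (0 : ℝ) 1, ∫ q in Ioo (0 : ℝ) 1, conj (u t) * t * u (t * q) *
        (((r ^ (a - 1) : ℝ) : ℂ) * Complex.exp (-((σ * (t * (1 - q)) : ℂ) * r)))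
        = ((r ^ (a - 1) : ℝ) : ℂ) * ∫ t in (0 : ℝ)..1, conj (u t) *
            ∫ τ in (0 : ℝ)..t, Complex.exp (-(σ * r * (t - τ))) * u τ := by
      rw [intervalIntegral.integral_of_le zero_le_one, integral_Ioc_eq_integral_Ioo,
        ← integral_const_mul]
      refine setIntegral_congr_fun measurableSet_Ioo fun t ht => ?_
      have hsub := intervalIntegral.smul_integral_comp_mul_left (a := 0) (b := 1)
        (fun τ : ℝ => Complex.exp (-(σ * r * (t - τ))) * u τ) t
      rw [mul_zero, mul_one] at hsub
      rw [← hsub, intervalIntegral.integral_of_le zero_le_one, integral_Ioc_eq_integral_Ioo,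
        Complex.real_smul, ← integral_const_mul, ← integral_const_mul, ← integral_const_mul]
      congr 1 with q
      rw [show -((σ * (t * (1 - q)) : ℂ) * r) = -(σ * r * (t - ((t * q : ℝ) : ℂ))) by
        push_cast; ring]
      ring
    rw [heq, Complex.re_ofReal_mul]
    positivity
  have hre : 0 ≤ (∫ r in Ioi (0 : ℝ), ∫ p : ℝ × ℝ,
      conj (u p.1) * p.1 * u (p.1 * p.2) *
        (((r ^ (a - 1) : ℝ) : ℂ) * Complex.exp (-((σ * (p.1 * (1 - p.2)) : ℂ) * r)))
      ∂((volume.restrict (Ioo (0 : ℝ) 1)).prod (volume.restrict (Ioo (0 : ℝ) 1)))).re := by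
    rw [← RCLike.re_to_complex, ← integral_re hint.integral_prod_right]
    exact integral_nonneg_of_ae hrhs
  rw [← hswap, hlhs, Complex.re_ofReal_mul] at hre
  exact nonneg_of_mul_nonneg_right hre hG

/-! ### Energy bound for second parameter one. -/

theorem mittagLeffler_zero_right {α : ℝ} (hα : 1 ≤ α) (γ : ℝ) :
    mittagLeffler α γ 0 = 1 / (Real.Gamma γ : ℂ) := by
  rw [mittagLeffler_eq_add_mul hα, zero_mul, add_zero]

/-- Since `1/Γ(0) = 0`, the function with second parameter `0` is `z E_{α,α}(z)`, and `z` cancels.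
-/
theorem deriv_mittagLeffler_one {α : ℝ} (hα : 1 ≤ α) {z : ℂ} (hz : z ≠ 0) :
    α * deriv (mittagLeffler α 1) z = mittagLeffler α α z := by
  have h := mul_deriv_mittagLeffler hα 1 z
  rw [sub_self, mittagLeffler_eq_add_mul hα 0] at h
  simp at h
  refine mul_left_cancel₀ hz ?_
  linear_combination h

open MeasureTheory Set ComplexConjugate in
/-- Energy estimate for the fractional oscillation equation solved by
`t ↦ E_{α,1}(-λ t ^ α)`. -/
theorem norm_mittagLeffler_one_neg_cpow_le {α : ℝ} (hα : 1 < α) (hα2 : α < 2) {σ : ℂ}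
    (hσ : 0 < σ.re) :
    ‖mittagLeffler α 1 (-(1 / σ) ^ ((2 - α : ℝ) : ℂ))‖ ≤ 1 := by
  set lam : ℂ := (1 / σ) ^ ((2 - α : ℝ) : ℂ) with hlam
  have hlam0 : lam ≠ 0 := by
    have hσ0 : σ ≠ 0 := by rintro rfl; simp at hσ
    rw [hlam, Complex.cpow_ne_zero_iff]
    exact Or.inl (one_div_ne_zero hσ0)
  set u : ℝ → ℂ := fun t => mittagLeffler α 1 (-lam * ((t ^ α : ℝ) : ℂ)) with hu
  set u' : ℝ → ℂ := fun t => deriv (mittagLeffler α 1) (-lam * ((t ^ α : ℝ) : ℂ)) *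
    (-lam * ((α * t ^ (α - 1) : ℝ) : ℂ)) with hu'
  have hE := differentiable_mittagLeffler hα.le 1
  have hder : ∀ t, HasDerivAt u (u' t) t := fun t => by
    have h1 := ((Real.hasDerivAt_rpow_const (x := t) (p := α) (Or.inr hα.le)).ofReal_comp).const_mul
      (-lam)
    exact (hE _).hasDerivAt.comp t h1
  have huc : Continuous u := continuous_iff_continuousAt.2 fun t => (hder t).continuousAt
  have hpc : Continuous fun t : ℝ => t ^ α := Real.continuous_rpow_const (by linarith)
  have hpc' : Continuous fun t : ℝ => t ^ (α - 1) := Real.continuous_rpow_const (by linarith)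
  have hE' : Continuous (deriv (mittagLeffler α 1)) := hE.contDiff.continuous_deriv (le_refl 1)
  have hu'c : Continuous u' := by fun_prop
  have hc : Continuous fun t => conj (u t) * u' t := (Complex.continuous_conj.comp huc).mul hu'c
  have hN : ∀ t ∈ uIcc (0 : ℝ) 1, HasDerivAt (fun t => ‖u t‖ ^ 2)
      (2 * (conj (u t) * u' t).re) t := fun t _ => by
    refine (hder t).norm_sq.congr_deriv ?_
    rw [Complex.inner]
    simp
    ring
  have hftc := intervalIntegral.integral_eq_sub_of_hasDerivAt hN
    (((Complex.continuous_re.comp hc).const_mul 2).intervalIntegrable 0 1)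
  have hre : (∫ t in (0 : ℝ)..1, conj (u t) * u' t).re
      = ∫ t in (0 : ℝ)..1, (conj (u t) * u' t).re :=
    (Complex.reCLM.intervalIntegral_comp_comm (hc.intervalIntegrable 0 1)).symm
  rw [intervalIntegral.integral_const_mul, ← hre, intervalIntegral.integral_of_le zero_le_one,
    integral_Ioc_eq_integral_Ioo] at hftc
  have hG : 0 < Real.Gamma (α - 1) := Real.Gamma_pos_of_pos (by linarith)
  -- The fractional equation for `u`, tested against `conj u`; the convolution is written with `τ =
  -- t q`.
  have hkey : (Real.Gamma (α - 1) : ℂ) * ∫ t in Ioo (0 : ℝ) 1, conj (u t) * u' t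
      = -∫ t in Ioo (0 : ℝ) 1, conj (u t) * (lam * ((t ^ (1 - (2 - α)) : ℝ) : ℂ) *
      ∫ q in Ioo (0 : ℝ) 1, (((1 - q) ^ (-(2 - α)) : ℝ) : ℂ) * u (t * q)) := by
    rw [← integral_const_mul, ← integral_neg]
    refine setIntegral_congr_fun measurableSet_Ioo fun t ht => ?_
    have ht' := ht.1
    have hz : -lam * ((t ^ α : ℝ) : ℂ) ≠ 0 :=
      mul_ne_zero (neg_ne_zero.2 hlam0) (Complex.ofReal_ne_zero.2 (by positivity))
    have h1 := deriv_mittagLeffler_one hα.le hz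
    have h2 := integral_rpow_mul_mittagLeffler hα.le one_pos (by linarith : 0 < α - 1)
      (-lam * ((t ^ α : ℝ) : ℂ))
    have h3 : ∫ q in Ioo (0 : ℝ) 1, (((1 - q) ^ (-(2 - α)) : ℝ) : ℂ) * u (t * q)
        = Real.Gamma (α - 1) * mittagLeffler α α (-lam * ((t ^ α : ℝ) : ℂ)) := by
      rw [add_sub_cancel] at h2
      rw [← h2]
      refine setIntegral_congr_fun measurableSet_Ioo fun q hq => ?_
      rw [hu]
      simp only [sub_self, Real.rpow_zero, one_mul]
      rw [Real.mul_rpow ht'.le hq.1.le, show -(2 - α) = α - 1 - 1 by ring]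
      push_cast
      rw [mul_assoc]
    rw [h3, ← h1, hu', show 1 - (2 - α) = α - 1 by ring]
    push_cast
    ring
  have hpos := re_integral_fractional_kernel_nonneg (a := 2 - α) (by linarith) (by linarith) hσ huc
  have hkey' := congrArg Complex.re hkey
  rw [Complex.re_ofReal_mul, Complex.neg_re] at hkey'
  have hle : (∫ t in Ioo (0 : ℝ) 1, conj (u t) * u' t).re ≤ 0 := by
    by_contra! h
    have := mul_pos hG h
    linarith
  have hu0 : u 0 = 1 := by
    simp [hu, Real.zero_rpow (by linarith : α ≠ 0), mittagLeffler_zero_right hα.le]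
  have hu1 : u 1 = mittagLeffler α 1 (-lam) := by simp [hu]
  rw [hu0, hu1, norm_one] at hftc
  nlinarith [norm_nonneg (mittagLeffler α 1 (-lam))]

/-- Take `1/σ = w^{1/(2-α)}`: the bound on the argument says exactly that `1/σ`, hence `σ`, has
positive real part. -/
theorem norm_mittagLeffler_one_neg_le {α : ℝ} (hα : 1 < α) (hα2 : α < 2) {w : ℂ} (hw : w ≠ 0)
    (harg : |w.arg| < (2 - α) * (Real.pi / 2)) : ‖mittagLeffler α 1 (-w)‖ ≤ 1 := by
  have ha : 0 < 2 - α := by linarith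
  have haC : ((2 - α : ℝ) : ℂ) ≠ 0 := Complex.ofReal_ne_zero.2 ha.ne'
  have him : (Complex.log w * ((2 - α)⁻¹ : ℝ)).im = w.arg / (2 - α) := by
    rw [Complex.im_mul_ofReal, Complex.log_im, div_eq_mul_inv]
  have hlt : |w.arg / (2 - α)| < Real.pi / 2 := by
    rw [abs_div, abs_of_pos ha, div_lt_iff₀ ha, mul_comm]
    exact harg
  obtain ⟨h1, h2⟩ := abs_lt.1 hlt
  have hpi := Real.pi_pos
  have hpow : (w ^ (((2 - α)⁻¹ : ℝ) : ℂ)) ^ ((2 - α : ℝ) : ℂ) = w := by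
    rw [← Complex.cpow_mul _ (by rw [him]; linarith) (by rw [him]; linarith), Complex.ofReal_inv,
      inv_mul_cancel₀ haC, Complex.cpow_one]
  have hre : 0 < (w ^ (((2 - α)⁻¹ : ℝ) : ℂ)).re := by
    rw [Complex.cpow_def_of_ne_zero hw, Complex.exp_re, him]
    exact mul_pos (Real.exp_pos _) (Real.cos_pos_of_mem_Ioo ⟨h1, h2⟩)
  have hne : w ^ (((2 - α)⁻¹ : ℝ) : ℂ) ≠ 0 := fun h => by
    rw [h, Complex.zero_re] at hre
    exact hre.false
  have h := norm_mittagLeffler_one_neg_cpow_le hα hα2 (σ := 1 / w ^ (((2 - α)⁻¹ : ℝ) : ℂ)) (by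
    rw [one_div, Complex.inv_re]
    exact div_pos hre (Complex.normSq_pos.2 hne))
  rwa [one_div_one_div, hpow] at h

/-! ### Sector bounds for every second parameter. -/

/-- `f` is bounded on a sector with vertex `0` around the negative real axis. -/
def BoundedNearNegAxis (f : ℂ → ℂ) : Prop :=
  ∃ κ C : ℝ, 0 < κ ∧ κ < 1 ∧ ∀ X : ℝ, 0 < X → ∀ w : ℂ, ‖w + X‖ ≤ κ * X → ‖f w‖ ≤ C

/-- The argument is invariant under positive scaling, so it suffices that `-w / X` is close to `1`.
-/
theorem boundedNearNegAxis_mittagLeffler_one {α : ℝ} (hα : 1 < α) (hα2 : α < 2) :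
    BoundedNearNegAxis (mittagLeffler α 1) := by
  have hpos : 0 < (2 - α) * (Real.pi / 2) := mul_pos (by linarith) (by positivity)
  have hcont := (Complex.continuousAt_arg (x := 1) (by simp)).abs
  have hev : ∀ᶠ w : ℂ in nhds 1, |w.arg| < (2 - α) * (Real.pi / 2) :=
    hcont.eventually_lt continuousAt_const (by simpa using hpos)
  obtain ⟨ε, hε, hball⟩ := Metric.eventually_nhds_iff.1 hev
  refine ⟨min (ε / 2) (1 / 2), 1, by positivity, (min_le_right _ _).trans_lt (by norm_num),
    fun X hX w hw => ?_⟩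
  have hXC : (X : ℂ) ≠ 0 := Complex.ofReal_ne_zero.2 hX.ne'
  have hd : ‖-w / X - 1‖ ≤ min (ε / 2) (1 / 2) := by
    rw [show -w / X - 1 = -(w + X) / X by field_simp; ring, norm_div, norm_neg, Complex.norm_real,
      Real.norm_of_nonneg hX.le]
    exact (div_le_iff₀ hX).2 hw
  have hw0 : w ≠ 0 := by
    rintro rfl
    have := hd.trans (min_le_right _ _)
    norm_num at this
  have harg := hball (y := -w / X) (by
    rw [dist_eq_norm]
    exact (hd.trans (min_le_left _ _)).trans_lt (by linarith))
  rw [show (-w / X : ℂ) = ((X⁻¹ : ℝ) : ℂ) * -w by push_cast; field_simp,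
    Complex.arg_real_mul _ (inv_pos.2 hX)] at harg
  simpa using norm_mittagLeffler_one_neg_le hα hα2 (neg_ne_zero.2 hw0) harg

/-- Cauchy's estimate on a circle of radius `κ X / 2` bounds the derivative by `O(1/X)`, which
absorbs the factor `z` in `mul_deriv_mittagLeffler`. The circle must stay in the old sector, so `κ`
is halved. -/
theorem BoundedNearNegAxis.mittagLeffler_sub_one {α γ : ℝ} (hα : 1 ≤ α)
    (h : BoundedNearNegAxis (mittagLeffler α γ)) :
    BoundedNearNegAxis (mittagLeffler α (γ - 1)) := by
  obtain ⟨κ, C, hκ, hκ1, hb⟩ := h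
  have hC : 0 ≤ C := (norm_nonneg _).trans (hb 1 one_pos (-1) (by simpa using hκ.le))
  refine ⟨κ / 2, α * (2 * (C / (κ / 2))) + |γ - 1| * C, by linarith, by linarith,
    fun X hX w hw => ?_⟩
  have hr : 0 < κ / 2 * X := by positivity
  have hd : ‖deriv (mittagLeffler α γ) w‖ ≤ C / (κ / 2 * X) := by
    refine Complex.norm_deriv_le_of_forall_mem_sphere_norm_le hr
      (differentiable_mittagLeffler hα γ).diffContOnCl fun z hz => hb X hX z ?_
    rw [mem_sphere_iff_norm] at hz
    calc ‖z + X‖ = ‖(z - w) + (w + X)‖ := by ring_nf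
      _ ≤ ‖z - w‖ + ‖w + X‖ := norm_add_le _ _
      _ ≤ κ * X := by rw [hz]; linarith
  have hwn : ‖w‖ ≤ 2 * X := by
    calc ‖w‖ = ‖(w + X) - X‖ := by ring_nf
      _ ≤ ‖w + X‖ + ‖(X : ℂ)‖ := norm_sub_le _ _
      _ ≤ 2 * X := by rw [Complex.norm_real, Real.norm_of_nonneg hX.le]; nlinarith
  have hE : ‖mittagLeffler α γ w‖ ≤ C := hb X hX w (hw.trans (by nlinarith))
  have heq : mittagLeffler α (γ - 1) w
      = α * (w * deriv (mittagLeffler α γ) w) + ((γ - 1 : ℝ) : ℂ) * mittagLeffler α γ w := by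
    rw [mul_deriv_mittagLeffler hα]; push_cast; ring
  rw [heq]
  refine (norm_add_le _ _).trans (add_le_add ?_ ?_)
  · rw [norm_mul, norm_mul, Complex.norm_real, Real.norm_of_nonneg (by linarith)]
    calc α * (‖w‖ * ‖deriv (mittagLeffler α γ) w‖)
        ≤ α * ((2 * X) * (C / (κ / 2 * X))) := by gcongr
      _ = α * (2 * (C / (κ / 2))) := by field_simp
  · rw [norm_mul, Complex.norm_real, Real.norm_eq_abs]
    gcongr

-- The fractional integral only involves the points `w q^α`, which lie in the same sector with `X`
-- replaced by `X q^α`.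
open MeasureTheory Set in
theorem BoundedNearNegAxis.mittagLeffler_add {α γ μ : ℝ} (hα : 1 ≤ α) (hγ : 0 < γ) (hμ : 0 < μ)
    (h : BoundedNearNegAxis (mittagLeffler α γ)) :
    BoundedNearNegAxis (mittagLeffler α (γ + μ)) := by
  obtain ⟨κ, C, hκ, hκ1, hb⟩ := h
  have hG := Real.Gamma_pos_of_pos hμ
  refine ⟨κ, (∫ q in Ioo (0 : ℝ) 1, q ^ (γ - 1) * (1 - q) ^ (μ - 1) * C) / Real.Gamma μ, hκ, hκ1,
    fun X hX w hw => ?_⟩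
  rw [le_div_iff₀ hG, mul_comm]
  have heq : Real.Gamma μ * ‖mittagLeffler α (γ + μ) w‖
      = ‖(Real.Gamma μ : ℂ) * mittagLeffler α (γ + μ) w‖ := by
    rw [norm_mul, Complex.norm_real, Real.norm_of_nonneg hG.le]
  rw [heq, ← integral_rpow_mul_mittagLeffler hα hγ hμ]
  refine norm_integral_le_of_norm_le ((integrableOn_rpow_mul_one_sub_rpow hγ hμ).mul_const C)
    ((ae_restrict_iff' measurableSet_Ioo).2 (.of_forall fun q hq => ?_))
  have hq0 := hq.1
  have hq1 : 0 < 1 - q := by linarith [hq.2]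
  have hqa : 0 < q ^ α := by positivity
  rw [norm_mul, Complex.norm_real, Real.norm_of_nonneg (by positivity)]
  have := hb (X * q ^ α) (by positivity) (w * (q ^ α : ℝ)) (by
    rw [Complex.ofReal_mul, ← add_mul, norm_mul, Complex.norm_real, Real.norm_of_nonneg hqa.le,
      ← mul_assoc]
    gcongr)
  gcongr

theorem boundedNearNegAxis_mittagLeffler {α : ℝ} (hα : 1 < α) (hα2 : α < 2) (γ : ℝ) :
    BoundedNearNegAxis (mittagLeffler α γ) := by
  -- Raise the parameter from `1` to `γ + n > 1`, then lower it `n` times by one.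
  obtain ⟨n, hn⟩ := exists_nat_gt (1 - γ)
  have h : ∀ m : ℕ, BoundedNearNegAxis (mittagLeffler α (γ + n - m)) := by
    intro m
    induction m with
    | zero =>
      have := (boundedNearNegAxis_mittagLeffler_one hα hα2).mittagLeffler_add (μ := γ + n - 1)
        hα.le one_pos (by linarith)
      simpa using this
    | succ m ih =>
      have := ih.mittagLeffler_sub_one hα.le
      rwa [sub_sub, ← Nat.cast_add_one] at this
  simpa using h n

/-! ### Comparison with the real axis by Taylor expansion. -/

/-- Second order Taylor estimate for an entire function bounded on a disc. -/
theorem Complex.norm_sub_sub_deriv_mul_le {g : ℂ → ℂ} (hg : Differentiable ℂ g) {c z : ℂ}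
    {r M : ℝ} (hr : 0 < r) (hM : ∀ w, ‖w - c‖ ≤ r → ‖g w‖ ≤ M) (hz : ‖z - c‖ ≤ r / 4) :
    ‖g z - g c - deriv g c * (z - c)‖ ≤ 8 * M / r ^ 2 * ‖z - c‖ ^ 2 := by
  have hg' : Differentiable ℂ (deriv g) :=
    fun w => ((hg.analyticAt w).deriv).differentiableAt
  -- Two nested Cauchy estimates, with radii `r / 2` and then `r / 4`, produce the constant `8 M /
  -- r²`.
  have h1 : ∀ w, ‖w - c‖ ≤ r / 2 → ‖deriv g w‖ ≤ M / (r / 2) := fun w hw =>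
    Complex.norm_deriv_le_of_forall_mem_sphere_norm_le (by positivity) hg.diffContOnCl
      fun v hv => hM v (by
        rw [mem_sphere_iff_norm] at hv
        linarith [norm_sub_le_norm_sub_add_norm_sub v w c])
  have h2 : ∀ w, ‖w - c‖ ≤ r / 4 → ‖deriv (deriv g) w‖ ≤ M / (r / 2) / (r / 4) := fun w hw =>
    Complex.norm_deriv_le_of_forall_mem_sphere_norm_le (by positivity) hg'.diffContOnCl
      fun v hv => h1 v (by
        rw [mem_sphere_iff_norm] at hv
        linarith [norm_sub_le_norm_sub_add_norm_sub v w c])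
  have hconst : M / (r / 2) / (r / 4) = 8 * M / r ^ 2 := by field_simp; ring
  have hball : ∀ w ∈ Metric.closedBall c ‖z - c‖, ‖w - c‖ ≤ ‖z - c‖ := fun w hw =>
    mem_closedBall_iff_norm.1 hw
  have hM0 : 0 ≤ M := (norm_nonneg _).trans (hM c (by simpa using hr.le))
  have hconv := convex_closedBall c ‖z - c‖
  have hcmem : c ∈ Metric.closedBall c ‖z - c‖ := by simp
  have hzmem : z ∈ Metric.closedBall c ‖z - c‖ := by simp [dist_eq_norm]
  have h3 : ∀ w ∈ Metric.closedBall c ‖z - c‖,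
      ‖deriv g w - deriv g c‖ ≤ 8 * M / r ^ 2 * ‖z - c‖ := fun w hw => by
    refine (hconv.norm_image_sub_le_of_norm_deriv_le (fun v _ => hg' v)
      (fun v hv => (h2 v ((hball v hv).trans hz)).trans_eq hconst) hcmem hw).trans ?_
    gcongr
    exact hball w hw
  have hder : ∀ w, HasDerivAt (fun w => g w - deriv g c * (w - c)) (deriv g w - deriv g c) w :=
    fun w => by
      have := (hg w).hasDerivAt.sub (((hasDerivAt_id w).sub_const c).const_mul (deriv g c))
      exact this.congr_deriv (by simp)
  have h4 := hconv.norm_image_sub_le_of_norm_hasDerivWithin_le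
    (fun w _ => (hder w).hasDerivWithinAt) h3 hcmem hzmem
  calc ‖g z - g c - deriv g c * (z - c)‖
      = ‖g z - deriv g c * (z - c) - (g c - deriv g c * (c - c))‖ := by ring_nf
    _ ≤ 8 * M / r ^ 2 * ‖z - c‖ * ‖z - c‖ := h4
    _ = _ := by ring

/-- If `F` is real on the real axis and `O(1/|z|)` near the negative real axis and `c > 0`, then
`|(c - F z) / z| < |(c - F (re z)) / re z|` for non-real `z` close to the axis and far to the
left. -/
theorem exists_norm_sub_mul_lt {F : ℂ → ℂ} (hF : Differentiable ℂ F)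
    (hreal : ∀ x : ℝ, (F x).im = 0) (hderiv : ∀ x : ℝ, x < 0 → (deriv F x).im = 0)
    {κ M c : ℝ} (hκ : 0 < κ) (hc : 0 < c)
    (hb : ∀ X : ℝ, 0 < X → ∀ w : ℂ, ‖w + X‖ ≤ κ * X → ‖F w‖ ≤ M / X) :
    ∃ R : ℝ, 0 < R ∧ ∀ z : ℂ, z.re < -R → z.im ≠ 0 → |z.im| < 1 →
      0 < c - (F z.re).re ∧ ‖c - F z‖ * -z.re < (c - (F z.re).re) * ‖z‖ := by
  have hM : 0 ≤ M := by
    simpa using (norm_nonneg _).trans (hb 1 one_pos (-1) (by simpa using hκ.le))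
  -- On the disc of radius `κ X` with bound `M / X`, the Taylor remainder is at most `A y² / X³` and
  -- the first derivative at most `B / X²`.
  set A := 8 * M / κ ^ 2 with hA
  set B := M / κ with hB
  have hA0 : 0 ≤ A := by positivity
  have hB0 : 0 ≤ B := by positivity
  set D := 4 * c * A + A ^ 2 + 2 * A * B + B ^ 2 with hD
  have hD0 : 0 ≤ D := by positivity
  -- The summands ensure in turn `X > 1`, `M / X < c / 2`, `|y| < κ X / 4` and `D / X < c² / 4`.
  refine ⟨1 + 2 * M / c + 4 / κ + 4 * D / c ^ 2, by positivity, fun z hz hy0 hy1 => ?_⟩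
  obtain ⟨X, hX⟩ : ∃ X, X = -z.re := ⟨_, rfl⟩
  have e1 : 0 ≤ 2 * M / c := by positivity
  have e2 : 0 ≤ 4 / κ := by positivity
  have e3 : 0 ≤ 4 * D / c ^ 2 := by positivity
  have hX1 : 1 < X := by linarith
  have hX0 : 0 < X := by linarith
  have hXM : 2 * M < X * c := (div_lt_iff₀ hc).1 (by linarith)
  have hXκ : 4 < X * κ := (div_lt_iff₀ hκ).1 (by linarith)
  have hXD : 4 * D < X * c ^ 2 := (div_lt_iff₀ (by positivity)).1 (by linarith)
  have hx : z.re = -X := by linarith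
  have hb' : ∀ w : ℂ, ‖w - (z.re : ℂ)‖ ≤ κ * X → ‖F w‖ ≤ M / X := fun w hw =>
    hb X hX0 w (by simpa [hx] using hw)
  have hzx : z - (z.re : ℂ) = z.im * Complex.I := by
    rw [sub_eq_iff_eq_add]; nth_rewrite 1 [← Complex.re_add_im z]; ring
  have hzn : ‖z - (z.re : ℂ)‖ = |z.im| := by
    rw [hzx, norm_mul, Complex.norm_I, mul_one, Complex.norm_real, Real.norm_eq_abs]
  have hκX : 0 < κ * X := by positivity
  have hT := Complex.norm_sub_sub_deriv_mul_le hF hκX hb' (z := z) (by rw [hzn]; linarith)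
  have hd : ‖deriv F (z.re : ℂ)‖ ≤ M / X / (κ * X) :=
    Complex.norm_deriv_le_of_forall_mem_sphere_norm_le hκX hF.diffContOnCl
      fun v hv => hb' v (mem_sphere_iff_norm.1 hv).le
  have hFx : ‖F (z.re : ℂ)‖ ≤ M / X := hb' _ (by simpa using hκX.le)
  set T := F z - F (z.re : ℂ) - deriv F (z.re : ℂ) * (z - (z.re : ℂ)) with hTdef
  set d := (deriv F (z.re : ℂ)).re with hddef
  set p := c - (F (z.re : ℂ)).re with hp
  set y := z.im with hy
  have hdeq : deriv F (z.re : ℂ) = (d : ℂ) :=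
    Complex.ext rfl (by simpa using hderiv z.re (by linarith))
  have hpeq : (c : ℂ) - F (z.re : ℂ) = (p : ℂ) :=
    Complex.ext (by simp [hp]) (by simpa using hreal z.re)
  -- As `d` is real and the displacement is `i y`, the linear term is orthogonal to `p`; so the
  -- squared norm exceeds `p²` only by terms of order `y²`.
  have hsplit : (c : ℂ) - F z = (p : ℂ) - T - (d * y : ℝ) * Complex.I := by
    rw [← hpeq, hTdef, hdeq, hzx]; push_cast; ring
  have hTn : ‖T‖ ≤ A * (y ^ 2 / X ^ 3) := by
    refine hT.trans_eq ?_
    rw [hzn, sq_abs, hA]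
    field_simp
  have hdn : |d| ≤ B / X ^ 2 := by
    refine (Complex.abs_re_le_norm _).trans (hd.trans_eq ?_)
    rw [hB]; field_simp
  have hMX : M / X < c / 2 := by
    rw [div_lt_div_iff₀ hX0 two_pos]; linarith
  have hFre := abs_le.1 ((Complex.abs_re_le_norm _).trans hFx)
  have hp1 : c / 2 < p := by rw [hp]; linarith [hFre.2]
  have hp2 : p < 2 * c := by rw [hp]; linarith [hFre.1]
  refine ⟨by linarith, ?_⟩
  set e := y ^ 2 / X ^ 3 with he
  have hy2 : y ^ 2 ≤ 1 := by rw [← sq_abs]; exact pow_le_one₀ (abs_nonneg _) hy1.le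
  have he0 : 0 ≤ e := by positivity
  have he1 : e ≤ 1 := by
    rw [he, div_le_one (by positivity)]
    exact hy2.trans (one_le_pow₀ hX1.le)
  have hdy : |d * y| ≤ B := by
    rw [abs_mul]
    calc |d| * |y| ≤ B / X ^ 2 * 1 := by gcongr
      _ ≤ B := by rw [mul_one]; exact div_le_self hB0 (one_le_pow₀ hX1.le)
  have hdy2 : (d * y) ^ 2 ≤ B ^ 2 * e := by
    rw [mul_pow, ← sq_abs d, he]
    calc |d| ^ 2 * y ^ 2 ≤ (B / X ^ 2) ^ 2 * y ^ 2 := by gcongr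
      _ = B ^ 2 * (y ^ 2 / X ^ 3) * (1 / X) := by field_simp
      _ ≤ B ^ 2 * (y ^ 2 / X ^ 3) := by
        refine mul_le_of_le_one_right (by positivity) ?_
        rw [div_le_one hX0]; exact hX1.le
  have hTabs : ‖T‖ ^ 2 = T.re ^ 2 + T.im ^ 2 := by
    rw [← Complex.normSq_eq_norm_sq, Complex.normSq_apply]; ring
  have hnsq : ‖(c : ℂ) - F z‖ ^ 2 = (p - T.re) ^ 2 + (T.im + d * y) ^ 2 := by
    rw [hsplit, ← Complex.normSq_eq_norm_sq, Complex.normSq_apply]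
    simp
    ring
  have hbound : ‖(c : ℂ) - F z‖ ^ 2 ≤ p ^ 2 + D * e := by
    have t1 : -(p * T.re) ≤ 2 * c * (A * e) := by
      calc -(p * T.re) ≤ |p * T.re| := neg_le_abs _
        _ = p * |T.re| := by rw [abs_mul, abs_of_pos (by linarith)]
        _ ≤ 2 * c * (A * e) := by
          gcongr
          exact (Complex.abs_re_le_norm T).trans hTn
    have t2 : T.im * (d * y) ≤ A * e * B := by
      calc T.im * (d * y) ≤ |T.im * (d * y)| := le_abs_self _
        _ = |T.im| * |d * y| := abs_mul _ _
        _ ≤ A * e * B := by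
          gcongr
          exact (Complex.abs_im_le_norm T).trans hTn
    have t3 : ‖T‖ ^ 2 ≤ A ^ 2 * e := by
      calc ‖T‖ ^ 2 ≤ (A * e) ^ 2 := by gcongr
        _ = A ^ 2 * e * e := by ring
        _ ≤ A ^ 2 * e := mul_le_of_le_one_right (by positivity) he1
    calc ‖(c : ℂ) - F z‖ ^ 2
        = p ^ 2 + (2 * -(p * T.re) + ‖T‖ ^ 2 + 2 * (T.im * (d * y)) + (d * y) ^ 2) := by
          rw [hnsq, hTabs]; ring
      _ ≤ p ^ 2 + (2 * (2 * c * (A * e)) + A ^ 2 * e + 2 * (A * e * B) + B ^ 2 * e) := by gcongr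
      _ = p ^ 2 + D * e := by rw [hD]; ring
  have hzsq : ‖z‖ ^ 2 = X ^ 2 + y ^ 2 := by
    rw [← Complex.normSq_eq_norm_sq, Complex.normSq_apply, hx]; ring
  have hypos : 0 < y ^ 2 := by positivity
  rw [← hX]
  refine lt_of_pow_lt_pow_left₀ 2 (mul_nonneg (by linarith) (norm_nonneg z)) ?_
  rw [mul_pow, mul_pow, hzsq]
  -- The cost `D e X² = (D / X) y²` is beaten by the gain `p² y²`, as `D / X < c² / 4 ≤ p²`.
  have hDe : D * e * X ^ 2 < p ^ 2 * y ^ 2 := by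
    have h1 : D * e * X ^ 2 = D / X * y ^ 2 := by rw [he]; field_simp
    rw [h1]
    refine mul_lt_mul_of_pos_right ?_ hypos
    rw [div_lt_iff₀ hX0]
    have hpp : (c / 2) ^ 2 ≤ p ^ 2 := by gcongr
    have := mul_le_mul_of_nonneg_right hpp hX0.le
    rw [div_pow] at this
    linarith
  calc ‖(c : ℂ) - F z‖ ^ 2 * X ^ 2 ≤ (p ^ 2 + D * e) * X ^ 2 := by gcongr
    _ < p ^ 2 * (X ^ 2 + y ^ 2) := by linarith

/-! ### Reality on the axis, decay, and the conclusion. -/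

theorem mittagLeffler_ofReal_im (α β x : ℝ) : (mittagLeffler α β (x : ℂ)).im = 0 := by
  rw [← mittagLeffler_ofReal]; exact Complex.ofReal_im _

theorem deriv_mittagLeffler_ofReal_im {α : ℝ} (hα : 1 ≤ α) (γ : ℝ) {x : ℝ} (hx : x ≠ 0) :
    (deriv (mittagLeffler α γ) (x : ℂ)).im = 0 := by
  have h := mul_deriv_mittagLeffler hα γ (x : ℂ)
  rw [← mittagLeffler_ofReal α (γ - 1), ← mittagLeffler_ofReal α γ, ← mul_assoc] at h
  have h' := congrArg Complex.im h
  rw [← Complex.ofReal_mul, Complex.im_ofReal_mul] at h'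
  have h0 : α * x ≠ 0 := mul_ne_zero (by linarith) hx
  refine (mul_eq_zero.1 (h'.trans ?_)).resolve_left h0
  simp

/-- Decay of the Mittag-Leffler function near the negative real axis. -/
theorem exists_norm_mittagLeffler_le_div {α : ℝ} (hα : 1 < α) (hα2 : α < 2) (γ : ℝ) :
    ∃ κ M : ℝ, 0 < κ ∧ ∀ X : ℝ, 0 < X → ∀ w : ℂ, ‖w + X‖ ≤ κ * X →
      ‖mittagLeffler α γ w‖ ≤ M / X := by
  -- The recursion from `γ - α` to `γ` divides a bounded quantity by `w`, and `‖w‖ ≥ (1 - κ) X`.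
  obtain ⟨κ, C, hκ, hκ1, hb⟩ := boundedNearNegAxis_mittagLeffler hα hα2 (γ - α)
  have h1κ : 0 < 1 - κ := by linarith
  refine ⟨κ, (C + ‖1 / (Real.Gamma (γ - α) : ℂ)‖) / (1 - κ), hκ, fun X hX w hw => ?_⟩
  have hrec := mittagLeffler_eq_add_mul hα.le (γ - α) w
  rw [sub_add_cancel] at hrec
  have hw' : (1 - κ) * X ≤ ‖w‖ := by
    have h := norm_sub_le (w + X) w
    rw [add_sub_cancel_left, Complex.norm_real, Real.norm_of_nonneg hX.le] at h
    linarith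
  have h1 : ‖w‖ * ‖mittagLeffler α γ w‖ ≤ C + ‖1 / (Real.Gamma (γ - α) : ℂ)‖ := by
    rw [← norm_mul, show w * mittagLeffler α γ w
      = mittagLeffler α (γ - α) w - 1 / (Real.Gamma (γ - α) : ℂ) by rw [hrec]; ring]
    exact (norm_sub_le _ _).trans (by gcongr; exact hb X hX w hw)
  rw [div_div, le_div_iff₀ (by positivity), mul_comm]
  exact (mul_le_mul_of_nonneg_right hw' (norm_nonneg _)).trans h1

/-- `Γ(s+2) = (s+1) s Γ(s)` with both factors negative. -/
theorem Real.Gamma_pos_of_mem_Ioo_neg_two_neg_one {s : ℝ} (h1 : -2 < s) (h2 : s < -1) :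
    0 < Real.Gamma s := by
  have e1 := Real.Gamma_add_one (s := s) (by linarith)
  have e2 := Real.Gamma_add_one (s := s + 1) (by linarith)
  have hpos : 0 < Real.Gamma (s + 1 + 1) := Real.Gamma_pos_of_pos (by linarith)
  rw [e2, e1, ← mul_assoc] at hpos
  exact pos_of_mul_pos_right hpos (mul_pos_of_neg_of_neg (by linarith) (by linarith)).le
/-- For `α ∈ (1, 2)` and `β ∈ [0, α - 1) ∪ (α, ∞)`, the inequality
`|E_{α,β}(z)| ≥ E_{α,β}(Re z)` does not hold on all of `ℂ`; in fact it fails for all non-real `z`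
with `Re z` close enough to `-∞` and `Im z` close enough to `0`. -/
theorem mainTheorem8 (α β : ℝ) (hα : α ∈ Set.Ioo (1 : ℝ) 2)
    (hβ : β ∈ Set.Ico (0 : ℝ) (α - 1) ∪ Set.Ioi α) :
    (¬ ∀ z : ℂ, (mittagLeffler α β (z.re : ℂ)).re ≤ ‖mittagLeffler α β z‖) ∧
    ∃ R : ℝ, ∃ δ : ℝ, 0 < δ ∧ ∀ z : ℂ, z.re < R → z.im ≠ 0 → |z.im| < δ →
      ‖mittagLeffler α β z‖ < (mittagLeffler α β (z.re : ℂ)).re := by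
  obtain ⟨hα1, hα2⟩ := hα
  -- The range of `β` enters through this sign: `β - α` lies in `(-2, -1)` or in `(0, ∞)`.
  have hG : 0 < Real.Gamma (β - α) := by
    rcases hβ with ⟨h0, h1⟩ | h
    · exact Real.Gamma_pos_of_mem_Ioo_neg_two_neg_one (by linarith) (by linarith)
    · exact Real.Gamma_pos_of_pos (sub_pos.2 h)
  have hfail : ∃ R : ℝ, ∃ δ : ℝ, 0 < δ ∧ ∀ z : ℂ, z.re < R → z.im ≠ 0 → |z.im| < δ →
      ‖mittagLeffler α β z‖ < (mittagLeffler α β (z.re : ℂ)).re := by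
    obtain ⟨κ, M, hκ, hb⟩ := exists_norm_mittagLeffler_le_div hα1 hα2 (β - α)
    obtain ⟨R, hR, h⟩ := exists_norm_sub_mul_lt (differentiable_mittagLeffler hα1.le (β - α))
      (mittagLeffler_ofReal_im α (β - α))
      (fun x hx => deriv_mittagLeffler_ofReal_im hα1.le (β - α) hx.ne) hκ
      (one_div_pos.2 hG) hb
    refine ⟨-R, 1, one_pos, fun z hz hy hy1 => ?_⟩
    obtain ⟨hp, hlt⟩ := h z hz hy hy1
    have hrec : ∀ w : ℂ, w * mittagLeffler α β w
        = -(((1 / Real.Gamma (β - α) : ℝ) : ℂ) - mittagLeffler α (β - α) w) := fun w => by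
      have := mittagLeffler_eq_add_mul hα1.le (β - α) w
      rw [sub_add_cancel] at this
      rw [this]; push_cast; ring
    have hX : 0 < -z.re := by linarith
    have hzn : 0 < ‖z‖ := norm_pos_iff.2 fun h0 => hy (by rw [h0, Complex.zero_im])
    have h1 : ‖z‖ * ‖mittagLeffler α β z‖
        = ‖((1 / Real.Gamma (β - α) : ℝ) : ℂ) - mittagLeffler α (β - α) z‖ := by
      rw [← norm_mul, hrec, norm_neg]
    have h2 : -z.re * (mittagLeffler α β (z.re : ℂ)).re
        = 1 / Real.Gamma (β - α) - (mittagLeffler α (β - α) (z.re : ℂ)).re := by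
      have := congrArg Complex.re (hrec (z.re : ℂ))
      rw [Complex.re_ofReal_mul, Complex.neg_re, Complex.sub_re, Complex.ofReal_re] at this
      linarith
    rw [← h1, ← h2] at hlt
    have h3 : ‖mittagLeffler α β z‖ * (‖z‖ * -z.re)
        < (mittagLeffler α β (z.re : ℂ)).re * (‖z‖ * -z.re) := by linarith
    exact lt_of_mul_lt_mul_right h3 (by positivity)
  refine ⟨fun hall => ?_, hfail⟩
  obtain ⟨R, δ, hδ, h⟩ := hfail
  have hlt := h ⟨R - 1, δ / 2⟩ (by simp) (by simpa using hδ.ne') (by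
    simp only
    rw [abs_of_pos (by linarith)]
    linarith)
  exact absurd (hall ⟨R - 1, δ / 2⟩) (not_le.2 hlt)
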